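/- **Lemma 6.1.** Let $X$ be a compact (Hausdorff) complex manifold, $E\to X$ a holomorphic line bundle with a smooth hermitian metric $h$, and let $-i\omega$ be the curvature form of $h$, so that locally $\omega=-i\partial\overline\partial\log h(e,e)$ for any nonvanishing holomorphic local section $e$ of $E$. Put $$\mathcal H_\omega=\{u\in C^\infty(X;\mathbb R):\ \omega+i\partial\overline\partial u>0\}.$$ Let $V$ be a complex linear subspace of the space $\mathcal O(E)$ of holomorphic sections of $E$, with a positive definite hermitian inner product $\langle\,,\rangle$. Let $\langle\langle\,,\rangle\rangle=\delta(V,\langle\,,\rangle)$ be the inner product on $\mathcal O(E)^*$ obtained by pulling back the dual inner product on $V^*$ along the restriction map $\mathcal O(E)^*\to V^*$. Its Bergman kernel $K(x,y)\in E_x\otimes\overline E_y$ is determined by $$\langle\langle \xi\,\mathrm{ev}_x,\eta\,\mathrm{ev}_y\rangle\rangle=(\xi\otimes\overline\eta)K(x,y)\qquad (x,y\in X,\ \xi\in E_x^*,\ \eta\in E_y^*),$$ where $\mathrm{ev}_x:\mathcal O(E)\to E_x$ is evaluation at $x$. Its Bergman function is $\kappa(x)=H(K(x,x))$, where $H:E_x\otimes\overline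 E_x\to\mathbb C$ is the linear map with $H(e\otimes f)=h(e,f)$. Call $V$ *rather ample* if for every $x\in X$ there is an $s\in V$ with $s(x)\neq0$, and for every $x\in X$ and every nonzero $v\in T^{10}_xX$ there is a $t\in V$ that vanishes at $x$, to first order in the direction $v$; that is, if $t=\varphi e$ with a nonvanishing holomorphic local section $e$ near $x$, then $\varphi(x)=0$ and $\partial\varphi(v)\neq0$. Then $\kappa>0$ everywhere on $X$ and $\log\kappa\in\mathcal H_\omega$ if and only if $V$ is rather ample. -/

import Mathlib

open scoped Manifold ContDiff TensorProduct ComplexConjugate Bundle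

noncomputable section

namespace BergmanLine

/-! ### Hermitian forms, linear in the first and conjugate linear in the second variable -/

section LinearAlgebra

variable {W : Type*} [AddCommGroup W] [Module ℂ W]

/-- A sesquilinear form is a positive definite inner product. -/
structure IsPosDefInner (g : W →ₗ[ℂ] W →ₗ⋆[ℂ] ℂ) : Prop where
  symm : ∀ s t, g t s = conj (g s t)
  pos : ∀ s, s ≠ 0 → 0 < (g s s).re

open Classical in
/-- The vector `v` that represents a linear form `τ` as `τ s = ⟨s, v⟩`. It exists and is unique
when `g` is a positive definite inner product on a finite dimensional space (spaces of holomorphic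
sections over a compact base are finite dimensional); the value is `0` when there is none. -/
def rieszVector (g : W →ₗ[ℂ] W →ₗ⋆[ℂ] ℂ) (τ : Module.Dual ℂ W) : W :=
  if h : ∃ v, ∀ s, τ s = g s v then h.choose else 0

/-- The inner product on `W^*` dual to `g`: if `σ = ⟨·, a⟩` and `τ = ⟨·, b⟩`, then
`⟨σ, τ⟩' = ⟨b, a⟩`. -/
def dualInner (g : W →ₗ[ℂ] W →ₗ⋆[ℂ] ℂ) (σ τ : Module.Dual ℂ W) : ℂ :=
  g (rieszVector g τ) (rieszVector g σ)

/-- `δ(V, ⟨,⟩)`: the dual inner product on `V^*`, pulled back to `W^*` by restriction of linear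
forms `W^* → V^*`. -/
def delta (V : Submodule ℂ W) (g : V →ₗ[ℂ] V →ₗ⋆[ℂ] ℂ) (σ τ : Module.Dual ℂ W) : ℂ :=
  dualInner g (σ.domRestrict V) (τ.domRestrict V)

variable (W) in
/-- The conjugate `W̄` of a complex vector space: the same real vector space, on which `c` acts as
`conj c` does on `W`. -/
def ConjSpace : Type _ := W

instance : AddCommGroup (ConjSpace W) := inferInstanceAs (AddCommGroup W)

instance : Module ℂ (ConjSpace W) := Module.compHom W (starRingEnd ℂ)

/-- The identity map `W̄ → W`, which is conjugate linear. -/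
def ConjSpace.toOrig : ConjSpace W →ₗ⋆[ℂ] W where
  toFun w := w
  map_add' _ _ := rfl
  map_smul' _ _ := rfl

/-- The identity map `W → W̄`, which is conjugate linear. -/
def ConjSpace.ofOrig : W →ₗ⋆[ℂ] ConjSpace W where
  toFun w := w
  map_add' _ _ := rfl
  map_smul' c w := by
    change c • w = conj (conj c) • w
    rw [Complex.conj_conj]

/-- The conjugate `η̄ ∈ W̄^*` of a linear form `η ∈ W^*`, that is `η̄ w = conj (η w)`. -/
def conjDual (η : Module.Dual ℂ W) : Module.Dual ℂ (ConjSpace W) where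
  toFun w := conj (η (ConjSpace.toOrig w))
  map_add' a b := by simp
  map_smul' c a := by simp [LinearMap.map_smulₛₗ]

/-- The linear map `W ⊗ W̄ → ℂ` induced by a sesquilinear form `g`, that is `e ⊗ f ↦ g(e, f)`. -/
def contract (g : W →ₗ[ℂ] W →ₗ⋆[ℂ] ℂ) : W ⊗[ℂ] ConjSpace W →ₗ[ℂ] ℂ :=
  TensorProduct.lift
    { toFun := fun e => (g e).comp ConjSpace.toOrig
      map_add' := fun a b => by ext; simp
      map_smul' := fun c a => by ext; simp }

end LinearAlgebra

/-! ### The operators `∂`, `∂̄` and `∂∂̄` on a complex vector space -/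

section Calculus

variable {B : Type*} [NormedAddCommGroup B] [NormedSpace ℂ B]

/-- `∂g(z)(v) = (D_v g(z) - i D_{iv} g(z)) / 2`. -/
def del (g : B → ℂ) (z v : B) : ℂ :=
  (1 / 2) * (fderiv ℝ g z v - Complex.I * fderiv ℝ g z (Complex.I • v))

/-- `∂̄g(z)(v) = (D_v g(z) + i D_{iv} g(z)) / 2`. -/
def delBar (g : B → ℂ) (z v : B) : ℂ :=
  (1 / 2) * (fderiv ℝ g z v + Complex.I * fderiv ℝ g z (Complex.I • v))

/-- The `(1,1)`-form `∂∂̄g = ∑ ∂²g/∂z_j∂z̄_k dz_j ∧ dz̄_k` at `z`, evaluated on `(v, w)`. -/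
def delDelBar (g : B → ℂ) (z v w : B) : ℂ :=
  del (fun y => delBar g y w) z v - del (fun y => delBar g y v) z w

end Calculus

/-! ### Compact complex manifolds and hermitian holomorphic line bundles -/

section Manifold

variable {B : Type*} [NormedAddCommGroup B] [NormedSpace ℂ B]
  {X : Type*} [TopologicalSpace X] [ChartedSpace B X]

/-- Complex valued 2-forms on `X`, as families of functions on pairs of tangent vectors. The
tangent space `TangentSpace 𝓘(ℂ, B) x` is identified with `B` by the preferred chart at `x`. -/
abbrev TwoForm (B : Type*) [NormedAddCommGroup B] [NormedSpace ℂ B]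
    (X : Type*) [TopologicalSpace X] [ChartedSpace B X] : Type _ :=
  ∀ x : X, TangentSpace 𝓘(ℂ, B) x → TangentSpace 𝓘(ℂ, B) x → ℂ

/-- `∂∂̄u` for a real function `u` on `X` (or one that is given only near `x`), computed at `x` in
the chart that identifies the tangent space with `B`. -/
def ddbar (u : X → ℝ) : TwoForm B X := fun x v w =>
  delDelBar (fun z => ((u ((extChartAt 𝓘(ℂ, B) x).symm z) : ℝ) : ℂ)) (extChartAt 𝓘(ℂ, B) x x) v w

/-- `η > 0` for a real `(1,1)`-form: `η(v, iv) > 0` for all nonzero tangent vectors `v`. -/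
def TwoForm.IsPositive (η : TwoForm B X) : Prop :=
  ∀ (x : X) (v : TangentSpace 𝓘(ℂ, B) x), v ≠ 0 → 0 < (η x v (Complex.I • v)).re

/-- `𝓗_w = {u ∈ C^∞(X) : w + i∂∂̄u > 0}`. -/
def potentials (w : TwoForm B X) : Set (X → ℝ) :=
  {u | ContMDiff 𝓘(ℝ, B) 𝓘(ℝ, ℝ) ∞ u ∧
    TwoForm.IsPositive (fun x v v' => w x v v' + Complex.I * ddbar u x v v')}

variable (E : X → Type*) [TopologicalSpace (Bundle.TotalSpace ℂ E)]
  [∀ x, TopologicalSpace (E x)] [∀ x, AddCommGroup (E x)] [∀ x, Module ℂ (E x)]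
  [FiberBundle ℂ E]

/-- A smooth hermitian metric on a complex line bundle. Smoothness is that of `h(e, e)` for the
local frames `e` given by the trivializations of the bundle. -/
structure HermitianMetric (B : Type*) [NormedAddCommGroup B] [NormedSpace ℂ B]
    {X : Type*} [TopologicalSpace X] [ChartedSpace B X]
    (E : X → Type*) [TopologicalSpace (Bundle.TotalSpace ℂ E)]
    [∀ x, TopologicalSpace (E x)] [∀ x, AddCommGroup (E x)] [∀ x, Module ℂ (E x)]
    [FiberBundle ℂ E] where
  form : ∀ x, E x →ₗ[ℂ] E x →ₗ⋆[ℂ] ℂ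
  posDef : ∀ x, IsPosDefInner (form x)
  smooth : ∀ e ∈ FiberBundle.trivializationAtlas (F := ℂ) (E := E),
    ContMDiffOn 𝓘(ℝ, B) 𝓘(ℝ, ℂ) ∞ (fun x => form x (e.symm x 1) (e.symm x 1)) e.baseSet

variable {E}

/-- The curvature form `Θ = ∂̄∂ log h(e, e) = -∂∂̄ log h(e, e)` of `h`, where `e` is a nonvanishing
holomorphic local section (here, the frame of the preferred trivialization at the point). -/
def HermitianMetric.curvature (h : HermitianMetric B E) : TwoForm B X := fun x v w =>
  -ddbar (fun y => Real.log
    (h.form y ((trivializationAt ℂ E x).symm y 1) ((trivializationAt ℂ E x).symm y 1)).re) x v w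

/-- The form `w` for which `-i w` is the curvature form of `h`. -/
def HermitianMetric.omega (h : HermitianMetric B E) : TwoForm B X := fun x v w =>
  Complex.I * h.curvature x v w

variable [VectorBundle ℂ ℂ E]

variable (B E) in
/-- The space `𝓞(E)` of holomorphic sections. -/
abbrev HolSections : Type _ := Cₛ^ω⟮𝓘(ℂ, B); ℂ, E⟯

/-- The evaluation map `ev_x : 𝓞(E) → E_x`. -/
def ev (x : X) : HolSections B E →ₗ[ℂ] E x where
  toFun s := s x
  map_add' _ _ := rfl
  map_smul' _ _ := rfl

open Classical in
/-- The Bergman kernel of an inner product `D` on `𝓞(E)^*`: `K(x, y) ∈ E_x ⊗ Ē_y` is the element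
with `⟨⟨ξ ev_x, η ev_y⟩⟩ = (ξ ⊗ η̄) K(x, y)` for all `ξ ∈ E_x^*`, `η ∈ E_y^*`. -/
def bergmanKernel (D : Module.Dual ℂ (HolSections B E) → Module.Dual ℂ (HolSections B E) → ℂ)
    (x y : X) : E x ⊗[ℂ] ConjSpace (E y) :=
  if h : ∃ K : E x ⊗[ℂ] ConjSpace (E y), ∀ (ξ : Module.Dual ℂ (E x)) (η : Module.Dual ℂ (E y)),
      D (ξ ∘ₗ ev x) (η ∘ₗ ev y)
        = TensorProduct.dualDistrib ℂ (E x) (ConjSpace (E y)) (ξ ⊗ₜ[ℂ] conjDual η) K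
  then h.choose else 0

/-- The Bergman section `k(x) = K(x, x)`. -/
def bergmanSection (D : Module.Dual ℂ (HolSections B E) → Module.Dual ℂ (HolSections B E) → ℂ)
    (x : X) : E x ⊗[ℂ] ConjSpace (E x) :=
  bergmanKernel D x x

/-- The Bergman function `κ = H ∘ k`, where `H(e ⊗ f) = h(e, f)`. It is real valued. -/
def bergmanFunction (h : HermitianMetric B E)
    (D : Module.Dual ℂ (HolSections B E) → Module.Dual ℂ (HolSections B E) → ℂ) (x : X) : ℝ :=
  (contract (h.form x) (bergmanSection D x)).re

/-- `V ⊂ 𝓞(E)` is rather ample: at every `x` some `s ∈ V` does not vanish, and for every nonzero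
tangent vector `v` at `x` some `t = φ e ∈ V` vanishes at `x` to first order in the direction `v`,
that is, `φ(x) = 0` and `∂φ(v) ≠ 0`; here `e` is a nonvanishing holomorphic local section.
(`TangentSpace 𝓘(ℂ, B) x` is the holomorphic tangent space `T^{10}_x X`.) -/
def IsRatherAmple (V : Submodule ℂ (HolSections B E)) : Prop :=
  ∀ x : X, (∃ s ∈ V, s x ≠ 0) ∧
    ∀ v : TangentSpace 𝓘(ℂ, B) x, v ≠ 0 → ∃ t ∈ V, t x = 0 ∧
      mfderiv 𝓘(ℂ, B) 𝓘(ℂ, ℂ)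
        (fun y => (trivializationAt ℂ E x (Bundle.TotalSpace.mk' ℂ y (t y))).2) x v ≠ (0 : ℂ)

end Manifold

end BergmanLine

end

/-! Let $s_1,\dots,s_n$ be an orthonormal basis of $V$. The dual inner product gives $K(x,x)=\sum
s_j(x)\otimes\overline{s_j(x)}$, hence $\kappa=\sum h(s_j,s_j)$, and $\kappa(x)>0$ exactly when some
section in $V$ is nonzero at $x$ (`bergmanFunction_eq_sum`, `bergmanFunction_pos_iff`).

Write $s_j=\varphi_j e$ in a local holomorphic frame. Then $\log\kappa=\log
h(e,e)+\log\sum|\varphi_j|^2$, and the first term cancels $\omega$, so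
$\omega+i\partial\overline\partial\log\kappa=i\partial\overline\partial\log\sum|\varphi_j|^2$
(`omega_add_ddbar_log_bergmanFunction`). On $(v,iv)$ this is a positive multiple of the Gram
determinant of $a=(\varphi_j(x))$ and $b=(\partial\varphi_j(v))$ (`I_mul_delDelBar_log_sum`). By
Cauchy–Schwarz, for $a\ne0$ it is positive iff $b$ is not a multiple of $a$, that is, iff some $c$
has $\sum c_ja_j=0\ne\sum c_jb_j$ (`gramDet_re_pos_iff`). Then $t=\sum c_js_j$ is the section that
rather ampleness asks for.

A finite basis exists because $\mathcal O(E)$ is finite dimensional: by the Schwarz lemma and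
compactness, a section vanishing at suitable finitely many points is zero
(`finiteDimensional_holSections`). -/

noncomputable section

namespace BergmanLine

/-! ### Inner products, their duals, and contraction on a line -/

section LinearAlgebra

variable {W : Type*} [AddCommGroup W] [Module ℂ W]

theorem IsPosDefInner.re_self_nonneg {g : W →ₗ[ℂ] W →ₗ⋆[ℂ] ℂ} (hg : IsPosDefInner g) (s : W) :
    0 ≤ (g s s).re := by
  rcases eq_or_ne s 0 with rfl | hs
  · simp
  · exact (hg.pos s hs).le

theorem IsPosDefInner.exists_orthonormal_basis [FiniteDimensional ℂ W]
    {g : W →ₗ[ℂ] W →ₗ⋆[ℂ] ℂ} (hg : IsPosDefInner g) :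
    ∃ (n : ℕ) (b : Module.Basis (Fin n) ℂ W), ∀ i j, g (b i) (b j) = if i = j then 1 else 0 := by
  let core : InnerProductSpace.Core ℂ W :=
    -- The arguments are swapped because `inner` is conjugate linear in its first variable.
    { inner := fun x y => g y x
      conj_inner_symm := fun x y => (hg.symm x y).symm
      re_inner_nonneg := fun x => hg.re_self_nonneg x
      add_left := fun x y z => by simp
      smul_left := fun x y r => by simp
      definite := fun x hx => by
        by_contra hne
        have := hg.pos x hne
        have hx' : g x x = 0 := hx
        rw [hx'] at this
        simp at this }
  let : NormedAddCommGroup W := core.toNormedAddCommGroup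
  let : InnerProductSpace ℂ W := InnerProductSpace.ofCore core.toCore
  refine ⟨_, (stdOrthonormalBasis ℂ W).toBasis, fun i j => ?_⟩
  have h := (orthonormal_iff_ite.mp (stdOrthonormalBasis ℂ W).orthonormal) j i
  simp only [OrthonormalBasis.coe_toBasis]
  have h' : g (stdOrthonormalBasis ℂ W i) (stdOrthonormalBasis ℂ W j) =
    if j = i then 1 else 0 := h
  rw [h']
  simp [eq_comm]

variable {n : ℕ} {g : W →ₗ[ℂ] W →ₗ⋆[ℂ] ℂ} {b : Module.Basis (Fin n) ℂ W}

/-- The vector $\sum\overline{\tau(b_j)}\,b_j$ represents $\tau$, so the default value in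
`rieszVector` does not occur. -/
theorem apply_rieszVector (hb : ∀ i j, g (b i) (b j) = if i = j then 1 else 0)
    (τ : Module.Dual ℂ W) (s : W) : τ s = g s (rieszVector g τ) := by
  have h : ∃ v, ∀ s, τ s = g s v := by
    refine ⟨∑ j, conj (τ (b j)) • b j, fun s => ?_⟩
    have key : τ = g.flip (∑ j, conj (τ (b j)) • b j) := by
      refine b.ext fun i => ?_
      simp [map_sum, hb]
    conv_lhs => rw [key]
    simp
  rw [rieszVector, dif_pos h]
  exact h.choose_spec s

theorem dualInner_eq_sum (hg : IsPosDefInner g)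
    (hb : ∀ i j, g (b i) (b j) = if i = j then 1 else 0) (σ τ : Module.Dual ℂ W) :
    dualInner g σ τ = ∑ j, σ (b j) * conj (τ (b j)) := by
  have hrepr : ∀ v j, b.repr v j = g v (b j) := by
    intro v j
    conv_rhs => rw [← b.sum_repr v]
    simp only [map_sum, map_smul, LinearMap.sum_apply, LinearMap.smul_apply, hb]
    simp
  rw [dualInner, ← apply_rieszVector hb σ]
  conv_lhs => rw [← b.sum_repr (rieszVector g τ)]
  rw [map_sum]
  refine Finset.sum_congr rfl fun j _ => ?_
  rw [map_smul, hrepr, hg.symm, ← apply_rieszVector hb τ, smul_eq_mul, mul_comm]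

/-- The Bergman kernel is known only through its pairings with $\xi\otimes\overline\eta$. On a line
a single such pairing determines the contraction, so uniqueness of the kernel is never needed. -/
theorem contract_eq_dualDistrib (f : W →ₗ[ℂ] W →ₗ⋆[ℂ] ℂ) (L : W ≃ₗ[ℂ] ℂ)
    (K : W ⊗[ℂ] ConjSpace W) :
    contract f K = TensorProduct.dualDistrib ℂ W (ConjSpace W)
      ((L : Module.Dual ℂ W) ⊗ₜ[ℂ] conjDual (L : Module.Dual ℂ W)) K *
        f (L.symm 1) (L.symm 1) := by
  induction K with
  | zero => simp
  | add a c ha hc => rw [map_add, map_add, ha, hc, add_mul]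
  | tmul e w =>
    have hL : ∀ u : W, u = L u • L.symm 1 := fun u => by
      rw [← map_smul, smul_eq_mul, mul_one, L.symm_apply_apply]
    have h1 : contract f (e ⊗ₜ[ℂ] w) = f e (ConjSpace.toOrig w) := rfl
    have h2 : conjDual (L : Module.Dual ℂ W) w = conj (L (ConjSpace.toOrig w)) := rfl
    rw [h1, TensorProduct.dualDistrib_apply, h2]
    conv_lhs => rw [hL e, hL (ConjSpace.toOrig w)]
    simp only [map_smulₛₗ, LinearMap.smul_apply, smul_eq_mul, LinearEquiv.coe_coe]
    simp only [RingHom.id_apply]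
    ring

end LinearAlgebra

/-! ### Gram determinants and the equality case of Cauchy–Schwarz -/

section Cauchy

variable {ι : Type*} [Fintype ι]

/-- The determinant `‖a‖²‖b‖² - |⟨a, b⟩|²` of the Gram matrix of `a` and `b` in `ℂ^ι`. -/
def gramDet (a b : ι → ℂ) : ℂ :=
  (∑ j, b j * conj (b j)) * (∑ j, a j * conj (a j)) -
    (∑ j, a j * conj (b j)) * ∑ j, b j * conj (a j)

/-- The Gram determinant of `a` and `b` is the squared norm of the component of `b` orthogonal to
`a`, up to the factor `‖a‖²`. -/
theorem sum_normSq_component (a b : ι → ℂ) :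
    ((∑ j, Complex.normSq
      ((∑ k, a k * conj (a k)) * b j - (∑ k, b k * conj (a k)) * a j) : ℝ) : ℂ)
      = (∑ j, a j * conj (a j)) * gramDet a b := by
  have hA : conj (∑ k, a k * conj (a k)) = ∑ k, a k * conj (a k) := by
    simp [map_sum, mul_comm]
  have hP : conj (∑ k, b k * conj (a k)) = ∑ k, a k * conj (b k) := by
    simp [map_sum, mul_comm]
  push_cast
  simp only [← Complex.mul_conj, map_sub, map_mul, hA, hP, gramDet]
  generalize hA' : ∑ k, a k * conj (a k) = A
  generalize hP' : ∑ k, b k * conj (a k) = P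
  generalize hQ' : ∑ k, a k * conj (b k) = Q
  generalize hB' : ∑ k, b k * conj (b k) = C
  have : ∀ j, (A * b j - P * a j) * (A * conj (b j) - Q * conj (a j)) =
      A * A * (b j * conj (b j)) - A * Q * (b j * conj (a j)) - P * A * (a j * conj (b j)) +
        P * Q * (a j * conj (a j)) := fun j => by ring
  simp only [this, Finset.sum_add_distrib, Finset.sum_sub_distrib, ← Finset.mul_sum, hA', hP', hQ',
    hB']
  ring

/-- Both sides say that $b$ is not a multiple of $a$: by `sum_normSq_component` the determinant is,
up to a positive factor, the squared norm of the part of $b$ orthogonal to $a$. -/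
theorem gramDet_re_pos_iff {a : ι → ℂ} (ha : a ≠ 0) (b : ι → ℂ) :
    0 < (gramDet a b).re ↔ ∃ c : ι → ℂ, ∑ j, c j * a j = 0 ∧ ∑ j, c j * b j ≠ 0 := by
  have hA : (∑ j, a j * conj (a j)) = ((∑ j, Complex.normSq (a j) : ℝ) : ℂ) := by
    push_cast
    simp [Complex.mul_conj]
  have hApos : 0 < ∑ j, Complex.normSq (a j) := by
    obtain ⟨j, hj⟩ := Function.ne_iff.mp ha
    exact Finset.sum_pos' (fun _ _ => Complex.normSq_nonneg _)
      ⟨j, Finset.mem_univ j, Complex.normSq_pos.mpr hj⟩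
  have key := congrArg Complex.re (sum_normSq_component a b)
  rw [Complex.ofReal_re, hA, Complex.re_ofReal_mul] at key
  constructor
  · intro hpos
    -- The witness is the conjugate of $\|a\|^2b-\langle b,a\rangle a$. Its pairing with $a$ is zero
    -- and its pairing with $b$ is the Gram determinant.
    refine ⟨fun j => conj (b j) * (∑ j, a j * conj (a j)) - conj (a j) * ∑ j, a j * conj (b j),
      ?_, fun h0 => ?_⟩
    · simp only [sub_mul, Finset.sum_sub_distrib]
      have h1 : ∀ j, conj (b j) * (∑ j, a j * conj (a j)) * a j =
        (∑ j, a j * conj (a j)) * (a j * conj (b j)) := fun j => by ring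
      have h2 : ∀ j, conj (a j) * (∑ j, a j * conj (b j)) * a j =
        (∑ j, a j * conj (b j)) * (a j * conj (a j)) := fun j => by ring
      simp only [h1, h2, ← Finset.mul_sum]
      ring
    · have : gramDet a b = 0 := by
        rw [← h0, gramDet]
        simp only [sub_mul, Finset.sum_sub_distrib]
        have h1 : ∀ j, conj (b j) * (∑ j, a j * conj (a j)) * b j =
          (∑ j, a j * conj (a j)) * (b j * conj (b j)) := fun j => by ring
        have h2 : ∀ j, conj (a j) * (∑ j, a j * conj (b j)) * b j =
          (∑ j, a j * conj (b j)) * (b j * conj (a j)) := fun j => by ring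
        simp only [h1, h2, ← Finset.mul_sum]
        ring
      simp [this] at hpos
  · rintro ⟨c, hca, hcb⟩
    -- If the orthogonal part vanished, pairing it with $c$ would give $\|a\|^2\sum c_jb_j=0$.
    have hne : ∃ j, (∑ k, a k * conj (a k)) * b j - (∑ k, b k * conj (a k)) * a j ≠ 0 := by
      by_contra! h0
      have h1 : ∑ j, c j * ((∑ k, a k * conj (a k)) * b j - (∑ k, b k * conj (a k)) * a j) =
        (∑ k, a k * conj (a k)) * ∑ j, c j * b j - (∑ k, b k * conj (a k)) * ∑ j, c j * a j := by
        rw [Finset.mul_sum, Finset.mul_sum, ← Finset.sum_sub_distrib]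
        exact Finset.sum_congr rfl fun j _ => by ring
      simp only [h0, mul_zero, Finset.sum_const_zero, hca, sub_zero] at h1
      have := mul_eq_zero.mp h1.symm
      rw [hA] at this
      exact this.elim (fun h => hApos.ne' (by exact_mod_cast h)) hcb
    obtain ⟨j, hj⟩ := hne
    have hs : 0 < ∑ j, Complex.normSq
        ((∑ k, a k * conj (a k)) * b j - (∑ k, b k * conj (a k)) * a j) :=
      Finset.sum_pos' (fun _ _ => Complex.normSq_nonneg _)
        ⟨j, Finset.mem_univ j, Complex.normSq_pos.mpr hj⟩
    rw [hA] at hs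
    rw [key] at hs
    exact (mul_pos_iff_of_pos_left hApos).mp hs

end Cauchy

/-! ### Calculus of $\partial$ and $\overline\partial$, and
$\partial\overline\partial\log\sum|\varphi_j|^2$ -/

section Calculus

variable {B : Type*} [NormedAddCommGroup B] [NormedSpace ℂ B]

theorem del_congr {f g : B → ℂ} {z : B} (h : f =ᶠ[nhds z] g) (v : B) : del f z v = del g z v := by
  simp only [del, h.fderiv_eq]

theorem delBar_congr {f g : B → ℂ} {z : B} (h : f =ᶠ[nhds z] g) (v : B) :
    delBar f z v = delBar g z v := by
  simp only [delBar, h.fderiv_eq]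

theorem delDelBar_congr {f g : B → ℂ} {z : B} (h : f =ᶠ[nhds z] g) (v w : B) :
    delDelBar f z v w = delDelBar g z v w := by
  have h' : ∀ u, (fun y => delBar f y u) =ᶠ[nhds z] fun y => delBar g y u := fun u =>
    h.eventuallyEq_nhds.mono fun y hy => delBar_congr hy u
  simp only [delDelBar, del_congr (h' _)]

theorem _root_.ContDiffAt.differentiableAt_delBar {f : B → ℂ} {z : B} (hf : ContDiffAt ℝ 2 f z)
    (w : B) : DifferentiableAt ℝ (fun y => delBar f y w) z := by
  have h : DifferentiableAt ℝ (fderiv ℝ f) z :=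
    (hf.fderiv_right (m := 1) (by norm_num)).differentiableAt (by norm_num)
  unfold delBar
  fun_prop

theorem delDelBar_add {f g : B → ℂ} {z : B} (hf : ContDiffAt ℝ 2 f z) (hg : ContDiffAt ℝ 2 g z)
    (v w : B) : delDelBar (fun y => f y + g y) z v w = delDelBar f z v w + delDelBar g z v w := by
  have h' : ∀ u, (fun y => delBar (fun y => f y + g y) y u) =ᶠ[nhds z]
      fun y => delBar f y u + delBar g y u := fun u => by
    filter_upwards [hf.eventually (by simp), hg.eventually (by simp)] with y hy hy'
    simp only [delBar]
    rw [fderiv_fun_add (hy.differentiableAt (by norm_num)) (hy'.differentiableAt (by norm_num))]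
    simp only [add_apply]
    ring
  have h : ∀ u t, del (fun y => delBar f y u + delBar g y u) z t =
      del (fun y => delBar f y u) z t + del (fun y => delBar g y u) z t := fun u t => by
    simp only [del]
    rw [fderiv_fun_add (hf.differentiableAt_delBar u) (hg.differentiableAt_delBar u)]
    simp only [add_apply]
    ring
  simp only [delDelBar, del_congr (h' _), h]
  ring

/-- `f` is real differentiable at `z`, with `∂f(z) = p` and `∂̄f(z) = q`. -/
def HasDels (f : B → ℂ) (p q : B → ℂ) (z : B) : Prop :=
  DifferentiableAt ℝ f z ∧ (∀ v, del f z v = p v) ∧ ∀ v, delBar f z v = q v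

theorem HasDels.add {f g : B → ℂ} {p q p' q' : B → ℂ} {z : B} (hf : HasDels f p q z)
    (hg : HasDels g p' q' z) : HasDels (fun y => f y + g y) (p + p') (q + q') z := by
  refine ⟨hf.1.add hg.1, fun v => ?_, fun v => ?_⟩
  · rw [Pi.add_apply, ← hf.2.1, ← hg.2.1, del, fderiv_fun_add hf.1 hg.1, del, del]
    simp only [add_apply]
    ring
  · rw [Pi.add_apply, ← hf.2.2, ← hg.2.2, delBar, fderiv_fun_add hf.1 hg.1, delBar, delBar]
    simp only [add_apply]
    ring

theorem hasDels_zero (z : B) : HasDels (fun _ => 0) 0 0 z := by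
  refine ⟨by fun_prop, fun v => ?_, fun v => ?_⟩ <;> simp [del, delBar]

theorem HasDels.sum {ι : Type*} {s : Finset ι} {f p q : ι → B → ℂ} {z : B}
    (h : ∀ i ∈ s, HasDels (f i) (p i) (q i) z) :
    HasDels (fun y => ∑ i ∈ s, f i y) (fun v => ∑ i ∈ s, p i v) (fun v => ∑ i ∈ s, q i v) z := by
  classical
  induction s using Finset.induction_on with
  | empty => simpa [Pi.zero_def] using hasDels_zero z
  | insert a s ha ih =>
    simp only [Finset.sum_insert ha]
    exact (h a (by simp)).add (ih fun i hi => h i (by simp [hi]))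

theorem HasDels.mul {f g : B → ℂ} {p q p' q' : B → ℂ} {z : B} (hf : HasDels f p q z)
    (hg : HasDels g p' q' z) : HasDels (fun y => f y * g y)
      (fun v => f z * p' v + g z * p v) (fun v => f z * q' v + g z * q v) z := by
  refine ⟨hf.1.mul hg.1, fun v => ?_, fun v => ?_⟩
  · beta_reduce
    rw [← hf.2.1, ← hg.2.1, del, fderiv_fun_mul hf.1 hg.1, del, del]
    simp
    ring
  · beta_reduce
    rw [← hf.2.2, ← hg.2.2, delBar, fderiv_fun_mul hf.1 hg.1, delBar, delBar]
    simp
    ring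

theorem HasDels.inv {g : B → ℂ} {p q : B → ℂ} {z : B} (hg : HasDels g p q z) (h0 : g z ≠ 0) :
    HasDels (fun y => (g y)⁻¹) (fun v => -p v / g z ^ 2) (fun v => -q v / g z ^ 2) z := by
  have hd : HasFDerivAt (fun y => (g y)⁻¹) _ z :=
    ((hasDerivAt_inv h0).hasFDerivAt.restrictScalars ℝ).comp z hg.1.hasFDerivAt
  refine ⟨hd.differentiableAt, fun v => ?_, fun v => ?_⟩
  · beta_reduce
    rw [← hg.2.1, del, hd.fderiv, del]
    simp
    ring
  · beta_reduce
    rw [← hg.2.2, delBar, hd.fderiv, delBar]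
    simp
    ring

theorem HasDels.div {f g : B → ℂ} {p q p' q' : B → ℂ} {z : B} (hf : HasDels f p q z)
    (hg : HasDels g p' q' z) (h0 : g z ≠ 0) : HasDels (fun y => f y / g y)
      (fun v => (g z * p v - f z * p' v) / g z ^ 2)
      (fun v => (g z * q v - f z * q' v) / g z ^ 2) z := by
  convert hf.mul (hg.inv h0) using 1 <;> funext v <;> field_simp <;> ring

theorem hasDels_of_differentiableAt {φ : B → ℂ} {z : B} (h : DifferentiableAt ℂ φ z) :
    HasDels φ (fun v => fderiv ℂ φ z v) 0 z := by
  refine ⟨h.restrictScalars ℝ, fun v => ?_, fun v => ?_⟩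
  · rw [del, h.fderiv_restrictScalars ℝ]
    simp [← mul_assoc]
    ring
  · rw [delBar, h.fderiv_restrictScalars ℝ]
    simp [← mul_assoc]

theorem HasDels.conj {f : B → ℂ} {p q : B → ℂ} {z : B} (hf : HasDels f p q z) :
    HasDels (fun y => conj (f y)) (fun v => conj (q v)) (fun v => conj (p v)) z := by
  have hd : HasFDerivAt (fun y => conj (f y))
      ((Complex.conjCLE : ℂ →L[ℝ] ℂ).comp (fderiv ℝ f z)) z :=
    (Complex.conjCLE : ℂ →L[ℝ] ℂ).hasFDerivAt.comp z hf.1.hasFDerivAt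
  refine ⟨hd.differentiableAt, fun v => ?_, fun v => ?_⟩
  · beta_reduce
    rw [← hf.2.2, del, hd.fderiv, delBar]
    simp [map_ofNat]
    ring
  · beta_reduce
    rw [← hf.2.1, delBar, hd.fderiv, del]
    simp [map_ofNat]

/-- `∂̄ log F = ∂̄F / F` for positive `F`. -/
theorem delBar_log {F : B → ℝ} {p q : B → ℂ} {z : B} (hF : HasDels (fun y => (F y : ℂ)) p q z)
    (h0 : 0 < F z) (v : B) : delBar (fun y => (Real.log (F y) : ℂ)) z v = q v / F z := by
  have hFd : DifferentiableAt ℝ F z := by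
    exact Complex.reCLM.differentiableAt.comp z hF.1
  have h1 : HasFDerivAt (fun y => (Real.log (F y) : ℂ))
      (Complex.ofRealCLM.comp ((F z)⁻¹ • fderiv ℝ F z)) z :=
    Complex.ofRealCLM.hasFDerivAt.comp z (hFd.hasFDerivAt.log h0.ne')
  have h2 : HasFDerivAt (fun y => (F y : ℂ)) (Complex.ofRealCLM.comp (fderiv ℝ F z)) z :=
    Complex.ofRealCLM.hasFDerivAt.comp z hFd.hasFDerivAt
  rw [← hF.2.2, delBar, delBar, h1.fderiv, h2.fderiv]
  simp
  field_simp

variable {ι : Type*} [Fintype ι]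

/-- If `φ_j` are holomorphic and `F = ∑ |φ_j|²` does not vanish at `z`, then
`i ∂∂̄ log F (v, iv)` is twice the Gram determinant of `φ` and `∂φ(v)`, divided by `F²`. -/
theorem I_mul_delDelBar_log_sum {φ : ι → B → ℂ} {z : B} (hφ : ∀ j, ContDiffAt ℂ 2 (φ j) z)
    (h0 : 0 < ∑ j, Complex.normSq (φ j z)) (v : B) :
    Complex.I * delDelBar (fun y => (Real.log (∑ j, Complex.normSq (φ j y)) : ℂ)) z v
        (Complex.I • v) =
      2 * gramDet (fun j => φ j z) (fun j => fderiv ℂ (φ j) z v) /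
        ((∑ j, Complex.normSq (φ j z) : ℝ) : ℂ) ^ 2 := by
  have hFdels : ∀ y, (∀ j, DifferentiableAt ℂ (φ j) y) →
      HasDels (fun y => ((∑ j, Complex.normSq (φ j y) : ℝ) : ℂ))
        (fun v => ∑ j, fderiv ℂ (φ j) y v * conj (φ j y))
        (fun v => ∑ j, φ j y * conj (fderiv ℂ (φ j) y v)) y := by
    intro y hy
    have := HasDels.sum (s := Finset.univ) (z := y) fun j _ =>
      (hasDels_of_differentiableAt (hy j)).mul (hasDels_of_differentiableAt (hy j)).conj
    convert this using 3 with u u u j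
    · push_cast
      exact Finset.sum_congr rfl fun j _ => (Complex.mul_conj _).symm
    · simp [mul_comm]
    · simp
  have hdiff : ∀ᶠ y in nhds z, ∀ j, DifferentiableAt ℂ (φ j) y :=
    Filter.eventually_all.mpr fun j => ((hφ j).eventually (by simp)).mono fun y hy =>
      hy.differentiableAt (by norm_num)
  have hcont : ContinuousAt (fun y => ∑ j, Complex.normSq (φ j y)) z :=
    tendsto_finsetSum _ fun j _ => Complex.continuous_normSq.continuousAt.comp (hφ j).continuousAt
  have hpos : ∀ᶠ y in nhds z, 0 < ∑ j, Complex.normSq (φ j y) := hcont.eventually (lt_mem_nhds h0)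
  -- The formula for $\overline\partial\log F$ is needed on a neighbourhood, since it is
  -- differentiated again.
  have hbar : ∀ w, (fun y => delBar (fun y => (Real.log (∑ j, Complex.normSq (φ j y)) : ℂ)) y w)
      =ᶠ[nhds z] fun y => (∑ j, φ j y * conj (fderiv ℂ (φ j) y w)) /
        ((∑ j, Complex.normSq (φ j y) : ℝ) : ℂ) := fun w => by
    filter_upwards [hdiff, hpos] with y hy hy'
    exact delBar_log (hFdels y hy) hy' w
  -- The factor $\overline{\partial\varphi_j(w)}$ is antiholomorphic, so $\partial$ of the numerator
  -- contains no second derivatives.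
  have hnum : ∀ w, HasDels (fun y => ∑ j, φ j y * conj (fderiv ℂ (φ j) y w))
      (fun v => ∑ j, fderiv ℂ (φ j) z v * conj (fderiv ℂ (φ j) z w))
      (fun v => ∑ j, φ j z * conj (fderiv ℂ (fun y => fderiv ℂ (φ j) y w) z v)) z := by
    intro w
    have hd : ∀ j, DifferentiableAt ℂ (fun y => fderiv ℂ (φ j) y w) z := fun j => by
      have h : DifferentiableAt ℂ (fderiv ℂ (φ j)) z :=
        ((hφ j).fderiv_right (m := 1) (by norm_num)).differentiableAt (by norm_num)
      fun_prop
    have := HasDels.sum (s := Finset.univ) (z := z) fun j _ =>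
      (hasDels_of_differentiableAt (hdiff.self_of_nhds j)).mul
        (hasDels_of_differentiableAt (hd j)).conj
    convert this using 3 with u u u j
    · simp [mul_comm]
    · simp
  have hne : (((∑ j, Complex.normSq (φ j z) : ℝ)) : ℂ) ≠ 0 := by exact_mod_cast h0.ne'
  have hmix : ∀ v w, del (fun y => delBar
      (fun y => (Real.log (∑ j, Complex.normSq (φ j y)) : ℂ)) y w) z v = _ := fun v w =>
    (del_congr (hbar w) v).trans
      (((hnum w).div (hFdels z hdiff.self_of_nhds) hne).2.1 v)
  -- The mixed derivative $M(v,w)$ is sesquilinear, so $M(v,iv)-M(iv,v)=-2iM(v,v)$; multiplication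
  -- by $i$ leaves $2M(v,v)$.
  rw [delDelBar, hmix, hmix]
  have hA : ((∑ j, Complex.normSq (φ j z) : ℝ) : ℂ) = ∑ j, φ j z * conj (φ j z) := by
    push_cast
    simp [Complex.mul_conj]
  have e1 : ∀ j, fderiv ℂ (φ j) z (Complex.I • v) = Complex.I * fderiv ℂ (φ j) z v := fun j => by
    simp
  simp only [e1, map_mul, Complex.conj_I, gramDet]
  rw [hA] at hne ⊢
  have e2 : ∀ j, fderiv ℂ (φ j) z v * (-Complex.I * conj (fderiv ℂ (φ j) z v)) =
    -Complex.I * (fderiv ℂ (φ j) z v * conj (fderiv ℂ (φ j) z v)) := fun j => by ring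
  have e3 : ∀ j, φ j z * (-Complex.I * conj (fderiv ℂ (φ j) z v)) =
    -Complex.I * (φ j z * conj (fderiv ℂ (φ j) z v)) := fun j => by ring
  simp only [e2, e3, mul_assoc Complex.I, ← Finset.mul_sum]
  field_simp
  ring_nf
  simp only [Complex.I_sq]
  ring

end Calculus

/-! ### Reading functions in the preferred chart -/

section Chart

variable {B : Type*} [NormedAddCommGroup B] [NormedSpace ℂ B]
  {X : Type*} [TopologicalSpace X] [ChartedSpace B X]
  {F : Type*} [NormedAddCommGroup F]

theorem continuousAt_of_comp_extChartAt_symm {f : X → F} {x : X}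
    (h : ContinuousAt (fun z => f ((extChartAt 𝓘(ℂ, B) x).symm z)) (extChartAt 𝓘(ℂ, B) x x)) :
    ContinuousAt f x := by
  have h' : ContinuousAt (fun y => f ((extChartAt 𝓘(ℂ, B) x).symm (extChartAt 𝓘(ℂ, B) x y))) x :=
    ContinuousAt.comp (f := extChartAt 𝓘(ℂ, B) x) h (continuousAt_extChartAt x)
  refine h'.congr ?_
  filter_upwards [extChartAt_source_mem_nhds (I := 𝓘(ℂ, B)) x] with y hy
  rw [(extChartAt 𝓘(ℂ, B) x).left_inv hy]

/-- The models $\mathcal I(\mathbb R,B)$ and $\mathcal I(\mathbb C,B)$ are both the identity on $B$,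
so their extended charts agree definitionally. -/
theorem contMDiffAt_real_iff [NormedSpace ℝ F] {f : X → F} {x : X} {n : ℕ∞ω} :
    ContMDiffAt 𝓘(ℝ, B) 𝓘(ℝ, F) n f x ↔
      ContDiffAt ℝ n (fun z => f ((extChartAt 𝓘(ℂ, B) x).symm z)) (extChartAt 𝓘(ℂ, B) x x) := by
  rw [contMDiffAt_iff]
  simp only [modelWithCornersSelf_coe, Set.range_id, contDiffWithinAt_univ]
  exact ⟨fun h => h.2, fun h => ⟨continuousAt_of_comp_extChartAt_symm h.continuousAt, h⟩⟩

end Chart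

/-! ### Local frames, and finite dimensionality of the space of sections -/

section Bundle

variable {B : Type*} [NormedAddCommGroup B] [NormedSpace ℂ B]
  {X : Type*} [TopologicalSpace X] [ChartedSpace B X]
  {E : X → Type*} [TopologicalSpace (Bundle.TotalSpace ℂ E)]
  [∀ x, TopologicalSpace (E x)] [∀ x, AddCommGroup (E x)] [∀ x, Module ℂ (E x)]
  [FiberBundle ℂ E]

variable (B E) in
/-- The image in the preferred chart at `x` of the domain on which the preferred trivialization
at `x` is defined. -/
def frameDomain (x : X) : Set B :=
  (extChartAt 𝓘(ℂ, B) x).target ∩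
    (extChartAt 𝓘(ℂ, B) x).symm ⁻¹' (trivializationAt ℂ E x).baseSet

omit [∀ x, AddCommGroup (E x)] [∀ x, Module ℂ (E x)] in
theorem isOpen_frameDomain (x : X) : IsOpen (frameDomain B E x) :=
  (continuousOn_extChartAt_symm x).isOpen_inter_preimage (isOpen_extChartAt_target x)
    (trivializationAt ℂ E x).open_baseSet

omit [∀ x, AddCommGroup (E x)] [∀ x, Module ℂ (E x)] in
theorem extChartAt_mem_frameDomain (x : X) : extChartAt 𝓘(ℂ, B) x x ∈ frameDomain B E x :=
  ⟨mem_extChartAt_target x, by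
    simp [FiberBundle.mem_baseSet_trivializationAt' x]⟩

omit [∀ x, AddCommGroup (E x)] [∀ x, Module ℂ (E x)] in
theorem frameDomain_mem_nhds (x : X) :
    frameDomain B E x ∈ nhds (extChartAt 𝓘(ℂ, B) x x) :=
  (isOpen_frameDomain x).mem_nhds (extChartAt_mem_frameDomain x)

/-- The squared norm `h(e, e)` of the frame `e` of the preferred trivialization at `x`. -/
def HermitianMetric.frameNormSq (h : HermitianMetric B E) (x y : X) : ℝ :=
  (h.form y ((trivializationAt ℂ E x).symm y 1) ((trivializationAt ℂ E x).symm y 1)).re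

theorem HermitianMetric.contDiffAt_frameNormSq (h : HermitianMetric B E) (x : X) :
    ContDiffAt ℝ ∞ (fun z => h.frameNormSq x ((extChartAt 𝓘(ℂ, B) x).symm z))
      (extChartAt 𝓘(ℂ, B) x x) := by
  have h1 := (h.smooth (trivializationAt ℂ E x)
    (FiberBundle.trivialization_mem_atlas ℂ E x)).contMDiffAt
      ((trivializationAt ℂ E x).open_baseSet.mem_nhds
        (FiberBundle.mem_baseSet_trivializationAt' x))
  exact Complex.reCLM.contDiff.contDiffAt.comp _ (contMDiffAt_real_iff.mp h1)

variable [VectorBundle ℂ ℂ E]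

theorem HermitianMetric.frameNormSq_pos (h : HermitianMetric B E) {x y : X}
    (hy : y ∈ (trivializationAt ℂ E x).baseSet) : 0 < h.frameNormSq x y := by
  refine (h.posDef y).pos _ fun h0 => ?_
  rw [← (trivializationAt ℂ E x).linearEquivAt_symm_apply (R := ℂ) y hy,
    LinearEquiv.map_eq_zero_iff] at h0
  exact one_ne_zero h0

/-- The coordinate `φ` of a section `s = φ e` with respect to the preferred chart and the preferred
trivialization at `x`. -/
def localCoord (x : X) (s : HolSections B E) (z : B) : ℂ :=
  (trivializationAt ℂ E x (Bundle.TotalSpace.mk' ℂ ((extChartAt 𝓘(ℂ, B) x).symm z)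
    (s ((extChartAt 𝓘(ℂ, B) x).symm z)))).2

theorem localCoord_eq {x : X} (s : HolSections B E) {z : B} (hz : z ∈ frameDomain B E x) :
    localCoord x s z = (trivializationAt ℂ E x).linearEquivAt ℂ _ hz.2
      (s ((extChartAt 𝓘(ℂ, B) x).symm z)) := by
  rw [Bundle.Trivialization.linearEquivAt_apply]
  rfl

theorem localCoord_sum_smul {x : X} {z : B} (hz : z ∈ frameDomain B E x) {ι : Type*}
    (t : Finset ι) (c : ι → ℂ) (s : ι → HolSections B E) :
    localCoord x (∑ i ∈ t, c i • s i) z = ∑ i ∈ t, c i * localCoord x (s i) z := by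
  have h : ∀ u, localCoord x u z =
      ((trivializationAt ℂ E x).linearEquivAt ℂ _ hz.2).toLinearMap.comp (ev _) u :=
    fun u => localCoord_eq u hz
  simp only [h]
  rw [map_sum]
  exact Finset.sum_congr rfl fun i _ => map_smul _ _ _

theorem localCoord_extChartAt_eq_zero_iff (x : X) (s : HolSections B E) :
    localCoord x s (extChartAt 𝓘(ℂ, B) x x) = 0 ↔ s x = 0 := by
  rw [localCoord_eq s (extChartAt_mem_frameDomain x), LinearEquiv.map_eq_zero_iff,
    extChartAt_to_inv]

theorem HermitianMetric.form_section_re (h : HermitianMetric B E) {x : X} (s : HolSections B E)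
    {z : B} (hz : z ∈ frameDomain B E x) :
    (h.form _ (s ((extChartAt 𝓘(ℂ, B) x).symm z)) (s ((extChartAt 𝓘(ℂ, B) x).symm z))).re =
      h.frameNormSq x ((extChartAt 𝓘(ℂ, B) x).symm z) * Complex.normSq (localCoord x s z) := by
  have hs : s ((extChartAt 𝓘(ℂ, B) x).symm z) = localCoord x s z •
      (trivializationAt ℂ E x).symm ((extChartAt 𝓘(ℂ, B) x).symm z) 1 := by
    rw [localCoord_eq s hz, ← (trivializationAt ℂ E x).linearEquivAt_symm_apply (R := ℂ) _ hz.2,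
      ← map_smul, smul_eq_mul, mul_one, LinearEquiv.symm_apply_apply]
  rw [hs, HermitianMetric.frameNormSq]
  simp only [map_smulₛₗ, LinearMap.smul_apply, smul_eq_mul, RingHom.id_apply]
  rw [← mul_assoc, mul_comm (conj _), Complex.mul_conj, Complex.re_ofReal_mul, mul_comm]

variable [IsManifold 𝓘(ℂ, B) ω X] [ContMDiffVectorBundle ω ℂ E 𝓘(ℂ, B)]

theorem contDiffOn_localCoord (x : X) (s : HolSections B E) :
    ContDiffOn ℂ ω (localCoord x s) (frameDomain B E x) := by
  have h1 := ((trivializationAt ℂ E x).contMDiffOn_section_baseSet_iff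
    (IB := 𝓘(ℂ, B)) (n := ω)).mp s.contMDiff.contMDiffOn
  have h2 := h1.comp ((contMDiffOn_extChartAt_symm (I := 𝓘(ℂ, B)) (n := ω) x).mono
    Set.inter_subset_left) (fun z hz => (hz.2 : _))
  exact contMDiffOn_iff_contDiffOn.mp h2

theorem contDiffAt_localCoord (x : X) (s : HolSections B E) :
    ContDiffAt ℂ ω (localCoord x s) (extChartAt 𝓘(ℂ, B) x x) :=
  (contDiffOn_localCoord x s).contDiffAt (frameDomain_mem_nhds x)

omit [IsManifold 𝓘(ℂ, B) ω X] in
-- Passes from the derivative in `IsRatherAmple` to the one in chart coordinates.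
theorem mfderiv_section_eq (x : X) (s : HolSections B E) (v : B) :
    mfderiv 𝓘(ℂ, B) 𝓘(ℂ, ℂ)
      (fun y => (trivializationAt ℂ E x (Bundle.TotalSpace.mk' ℂ y (s y))).2) x v =
      fderiv ℂ (localCoord x s) (extChartAt 𝓘(ℂ, B) x x) v := by
  have h1 : MDifferentiableAt 𝓘(ℂ, B) 𝓘(ℂ, ℂ)
      (fun y => (trivializationAt ℂ E x (Bundle.TotalSpace.mk' ℂ y (s y))).2) x :=
    (((trivializationAt ℂ E x).contMDiffAt_section_iff (IB := 𝓘(ℂ, B)) (n := ω)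
      (FiberBundle.mem_baseSet_trivializationAt' x)).mp s.contMDiff.contMDiffAt).mdifferentiableAt
      (by simp)
  rw [h1.mfderiv]
  simp only [modelWithCornersSelf_coe, Set.range_id, fderivWithin_univ]
  rfl

/-- A section of norm at most `M` that vanishes at `x` has norm at most `M / 2` on a neighbourhood
of `x` that does not depend on the section (all norms are squared). -/
theorem HermitianMetric.exists_nhds_form_le_half (h : HermitianMetric B E) (x : X) :
    ∃ U ∈ nhds x, ∀ (s : HolSections B E) (M : ℝ), s x = 0 →
      (∀ y, (h.form y (s y) (s y)).re ≤ M) → ∀ y ∈ U, (h.form y (s y) (s y)).re ≤ M / 2 := by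
  set z₀ := extChartAt 𝓘(ℂ, B) x x with hz₀
  set ρ : B → ℝ := fun z => h.frameNormSq x ((extChartAt 𝓘(ℂ, B) x).symm z) with hρ
  have hρ0 : 0 < ρ z₀ := h.frameNormSq_pos (extChartAt_mem_frameDomain x).2
  have hcont : ContinuousAt ρ z₀ := (h.contDiffAt_frameNormSq x).continuousAt
  -- On a small ball, chosen independently of $s$, the weight $\rho$ stays within a factor 2 of
  -- $\rho(z_0)$.
  have hev : ∀ᶠ z in nhds z₀, z ∈ frameDomain B E x ∧ ρ z₀ / 2 < ρ z ∧ ρ z < 2 * ρ z₀ :=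
    (Filter.Eventually.and (frameDomain_mem_nhds (E := E) x)
      ((hcont.eventually (lt_mem_nhds (by linarith))).and
        (hcont.eventually (gt_mem_nhds (by linarith)))))
  obtain ⟨R, hR, hball⟩ := Metric.eventually_nhds_iff_ball.mp hev
  -- At radius $R/4$ the Schwarz lemma gains $1/16$ in the squared norm, while the two comparisons
  -- of $\rho$ with $\rho(z_0)$ lose at most 4; the result $M/4$ is below $M/2$.
  refine ⟨(extChartAt 𝓘(ℂ, B) x).source ∩ extChartAt 𝓘(ℂ, B) x ⁻¹' Metric.ball z₀ (R / 4),
    Filter.inter_mem (extChartAt_source_mem_nhds x)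
      ((continuousAt_extChartAt x).preimage_mem_nhds (Metric.ball_mem_nhds _ (by positivity))), ?_⟩
  rintro s M hs0 hM y ⟨hy, hyR⟩
  have hform : ∀ z ∈ Metric.ball z₀ R, ρ z * Complex.normSq (localCoord x s z) ≤ M := fun z hz => by
    rw [← h.form_section_re s (hball z hz).1]
    exact hM _
  have hbound : ∀ z ∈ Metric.ball z₀ R, ‖localCoord x s z‖ ≤ √(2 * M / ρ z₀) := fun z hz => by
    refine Real.le_sqrt_of_sq_le ?_
    rw [← Complex.normSq_eq_norm_sq, le_div_iff₀ hρ0]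
    nlinarith [hform z hz, (hball z hz).2.1, Complex.normSq_nonneg (localCoord x s z)]
  have hzero : localCoord x s z₀ = 0 := (localCoord_extChartAt_eq_zero_iff x s).mpr hs0
  have hM0 : 0 ≤ M := by
    have := hform z₀ (Metric.mem_ball_self hR)
    rwa [hzero, map_zero, mul_zero] at this
  set z := extChartAt 𝓘(ℂ, B) x y with hz
  have hz4 : ‖z - z₀‖ < R / 4 := mem_ball_iff_norm.mp hyR
  have hzR : z ∈ Metric.ball z₀ R := Metric.ball_subset_ball (by linarith) hyR
  have hschwarz := Complex.dist_le_div_mul_dist_of_mapsTo_ball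
    ((contDiffOn_localCoord x s).differentiableOn (by simp) |>.mono fun z hz => (hball z hz).1)
    (R₂ := √(2 * M / ρ z₀)) (fun z hz => by
      rw [hzero]; simpa using hbound z hz) hzR
  rw [hzero, dist_zero_right, dist_eq_norm] at hschwarz
  have hquarter : ‖localCoord x s z‖ ≤ √(2 * M / ρ z₀) / 4 := by
    refine hschwarz.trans ?_
    rw [div_mul_eq_mul_div, div_le_iff₀ hR]
    nlinarith [Real.sqrt_nonneg (2 * M / ρ z₀)]
  have hsq : Complex.normSq (localCoord x s z) ≤ M / (8 * ρ z₀) := by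
    rw [Complex.normSq_eq_norm_sq]
    calc ‖localCoord x s z‖ ^ 2 ≤ (√(2 * M / ρ z₀) / 4) ^ 2 := by gcongr
      _ = M / (8 * ρ z₀) := by
        rw [div_pow, Real.sq_sqrt (by positivity)]
        field_simp
        ring
  have hfinal := h.form_section_re s (hball z hzR).1
  rw [hz, (extChartAt 𝓘(ℂ, B) x).left_inv hy] at hfinal
  rw [hfinal]
  have h2 : ρ z * Complex.normSq (localCoord x s z) ≤ 2 * ρ z₀ * (M / (8 * ρ z₀)) :=
    mul_le_mul (hball z hzR).2.2.le hsq (Complex.normSq_nonneg _) (by positivity)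
  have h3 : 2 * ρ z₀ * (M / (8 * ρ z₀)) = M / 4 := by field_simp; ring
  have h4 : h.frameNormSq x y = ρ z := by
    rw [hρ, hz]
    beta_reduce
    rw [(extChartAt 𝓘(ℂ, B) x).left_inv hy]
  rw [h4]
  linarith

theorem HermitianMetric.continuous_form_section (h : HermitianMetric B E) (s : HolSections B E) :
    Continuous fun y => (h.form y (s y) (s y)).re := by
  refine continuous_iff_continuousAt.mpr fun x =>
    continuousAt_of_comp_extChartAt_symm (B := B) ?_
  have h1 : ContinuousAt (fun z => h.frameNormSq x ((extChartAt 𝓘(ℂ, B) x).symm z) *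
      Complex.normSq (localCoord x s z)) (extChartAt 𝓘(ℂ, B) x x) :=
    (h.contDiffAt_frameNormSq x).continuousAt.mul
      (Complex.continuous_normSq.continuousAt.comp (contDiffAt_localCoord x s).continuousAt)
  refine h1.congr ?_
  filter_upwards [frameDomain_mem_nhds (E := E) x] with z hz
  exact (h.form_section_re s hz).symm

/-- The space of holomorphic sections of a hermitian line bundle on a compact complex manifold is
finite dimensional. -/
theorem HermitianMetric.finiteDimensional_holSections [CompactSpace X] (h : HermitianMetric B E) :
    FiniteDimensional ℂ (HolSections B E) := by
  choose U hU hhalf using h.exists_nhds_form_le_half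
  obtain ⟨t, -, ht⟩ := isCompact_univ.elim_nhds_subcover U fun x _ => hU x
  have hfin : ∀ x, FiniteDimensional ℂ (E x) := fun x =>
    ((trivializationAt ℂ E x).linearEquivAt ℂ x
      (FiberBundle.mem_baseSet_trivializationAt' x)).symm.finiteDimensional
  -- Evaluation at the centres of a finite subcover embeds $\mathcal O(E)$ in a finite product of
  -- lines.
  have hinj : Function.Injective
      (LinearMap.pi fun x : t => (ev (x : X) : HolSections B E →ₗ[ℂ] E x)) := by
    refine (injective_iff_map_eq_zero _).mpr fun s hs => ?_
    have hs0 : ∀ x ∈ t, s x = 0 := fun x hx => congrFun hs ⟨x, hx⟩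
    ext y
    have : Nonempty X := ⟨y⟩
    -- The maximum of $h(s,s)$ is at most half of itself, hence not positive.
    obtain ⟨m, -, hm⟩ := isCompact_univ.exists_isMaxOn Set.univ_nonempty
      (h.continuous_form_section s).continuousOn
    obtain ⟨x, hx, hmx⟩ := Set.mem_iUnion₂.mp (ht (Set.mem_univ m))
    have h1 := hhalf x s _ (hs0 x hx) (fun y => hm (Set.mem_univ y)) m hmx
    have h2 : (h.form y (s y) (s y)).re ≤ (h.form m (s m) (s m)).re := hm (Set.mem_univ y)
    by_contra hne
    have h3 := (h.posDef y).pos (s y) hne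
    linarith
  exact FiniteDimensional.of_injective _ hinj

end Bundle

/-! ### The Bergman function and the positivity of $\omega+i\partial\overline\partial\log\kappa$ -/

section Bergman

variable {B : Type*} [NormedAddCommGroup B] [NormedSpace ℂ B]
  {X : Type*} [TopologicalSpace X] [ChartedSpace B X]
  {E : X → Type*} [TopologicalSpace (Bundle.TotalSpace ℂ E)]
  [∀ x, TopologicalSpace (E x)] [∀ x, AddCommGroup (E x)] [∀ x, Module ℂ (E x)]
  [FiberBundle ℂ E] [VectorBundle ℂ ℂ E]
  {V : Submodule ℂ (HolSections B E)} {g : V →ₗ[ℂ] V →ₗ⋆[ℂ] ℂ}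
  {n : ℕ} {b : Module.Basis (Fin n) ℂ V}

/-- The sum $\sum s_j\otimes\overline{s_j}$ satisfies the defining identity of the kernel, so a
kernel exists, and the chosen one has the same pairings. -/
theorem bergmanSection_spec (hg : IsPosDefInner g)
    (hb : ∀ i j, g (b i) (b j) = if i = j then 1 else 0) (x : X) (ξ η : Module.Dual ℂ (E x)) :
    TensorProduct.dualDistrib ℂ (E x) (ConjSpace (E x)) (ξ ⊗ₜ[ℂ] conjDual η)
        (bergmanSection (delta V g) x) =
      TensorProduct.dualDistrib ℂ (E x) (ConjSpace (E x)) (ξ ⊗ₜ[ℂ] conjDual η)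
        (∑ j, (b j : HolSections B E) x ⊗ₜ[ℂ] ConjSpace.ofOrig ((b j : HolSections B E) x)) := by
  have hsum : ∀ ξ η : Module.Dual ℂ (E x), delta V g (ξ ∘ₗ ev x) (η ∘ₗ ev x) =
      TensorProduct.dualDistrib ℂ (E x) (ConjSpace (E x)) (ξ ⊗ₜ[ℂ] conjDual η)
        (∑ j, (b j : HolSections B E) x ⊗ₜ[ℂ] ConjSpace.ofOrig ((b j : HolSections B E) x)) := by
    intro ξ η
    rw [delta, dualInner_eq_sum hg hb, map_sum]
    rfl
  have hex : ∃ K : E x ⊗[ℂ] ConjSpace (E x), ∀ ξ η : Module.Dual ℂ (E x),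
      delta V g (ξ ∘ₗ ev x) (η ∘ₗ ev x) =
        TensorProduct.dualDistrib ℂ (E x) (ConjSpace (E x)) (ξ ⊗ₜ[ℂ] conjDual η) K := ⟨_, hsum⟩
  rw [bergmanSection, bergmanKernel, dif_pos hex, ← hex.choose_spec ξ η, hsum]

/-- The Bergman function is the sum of the squared norms of an orthonormal basis. -/
theorem bergmanFunction_eq_sum (h : HermitianMetric B E) (hg : IsPosDefInner g)
    (hb : ∀ i j, g (b i) (b j) = if i = j then 1 else 0) (x : X) :
    bergmanFunction h (delta V g) x =
      ∑ j, (h.form x ((b j : HolSections B E) x) ((b j : HolSections B E) x)).re := by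
  have L : E x ≃ₗ[ℂ] ℂ := (trivializationAt ℂ E x).linearEquivAt ℂ x
    (FiberBundle.mem_baseSet_trivializationAt' x)
  -- The contraction is turned into a pairing, where the chosen kernel may be replaced by the
  -- explicit sum, and then turned back.
  rw [bergmanFunction, contract_eq_dualDistrib _ L, bergmanSection_spec hg hb,
    ← contract_eq_dualDistrib, map_sum, Complex.re_sum]
  rfl

theorem bergmanFunction_eq_frameNormSq_mul (h : HermitianMetric B E) (hg : IsPosDefInner g)
    (hb : ∀ i j, g (b i) (b j) = if i = j then 1 else 0) {x : X} {z : B}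
    (hz : z ∈ frameDomain B E x) :
    bergmanFunction h (delta V g) ((extChartAt 𝓘(ℂ, B) x).symm z) =
      h.frameNormSq x ((extChartAt 𝓘(ℂ, B) x).symm z) *
        ∑ j, Complex.normSq (localCoord x (b j : HolSections B E) z) := by
  rw [bergmanFunction_eq_sum h hg hb, Finset.mul_sum]
  exact Finset.sum_congr rfl fun j _ => h.form_section_re _ hz

theorem bergmanFunction_pos_iff_sum_normSq_pos (h : HermitianMetric B E) (hg : IsPosDefInner g)
    (hb : ∀ i j, g (b i) (b j) = if i = j then 1 else 0) (x : X) :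
    0 < bergmanFunction h (delta V g) x ↔ 0 < ∑ j, Complex.normSq
      (localCoord x (b j : HolSections B E) (extChartAt 𝓘(ℂ, B) x x)) := by
  have h1 := bergmanFunction_eq_frameNormSq_mul h hg hb (extChartAt_mem_frameDomain (E := E) x)
  rw [extChartAt_to_inv] at h1
  rw [h1, mul_pos_iff_of_pos_left
    (h.frameNormSq_pos (FiberBundle.mem_baseSet_trivializationAt' x))]

/-- A sum of nonnegative terms is positive iff some term is; and if all basis sections vanish at
$x$, evaluation at $x$ is zero on $V$. -/
theorem bergmanFunction_pos_iff (h : HermitianMetric B E) (hg : IsPosDefInner g)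
    (hb : ∀ i j, g (b i) (b j) = if i = j then 1 else 0) (x : X) :
    0 < bergmanFunction h (delta V g) x ↔ ∃ s ∈ V, s x ≠ 0 := by
  have hnonneg : ∀ j ∈ Finset.univ,
      0 ≤ (h.form x ((b j : HolSections B E) x) ((b j : HolSections B E) x)).re :=
    fun j _ => (h.posDef x).re_self_nonneg _
  rw [bergmanFunction_eq_sum h hg hb]
  constructor
  · intro hpos
    obtain ⟨j, -, hj⟩ := Finset.exists_ne_zero_of_sum_ne_zero hpos.ne'
    exact ⟨b j, (b j).2, fun h0 => hj (by simp [h0])⟩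
  · rintro ⟨s, hs, hsx⟩
    have hex : ∃ j, (b j : HolSections B E) x ≠ 0 := by
      by_contra! h0
      have hker : (ev x ∘ₗ V.subtype : V →ₗ[ℂ] E x) = 0 := b.ext fun j => h0 j
      exact hsx (LinearMap.congr_fun hker ⟨s, hs⟩)
    obtain ⟨j, hj⟩ := hex
    exact Finset.sum_pos' hnonneg ⟨j, Finset.mem_univ j, (h.posDef x).pos _ hj⟩

variable [IsManifold 𝓘(ℂ, B) ω X] [ContMDiffVectorBundle ω ℂ E 𝓘(ℂ, B)]

theorem contDiffAt_sum_normSq_localCoord (x : X) {ι : Type*} [Fintype ι]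
    (s : ι → HolSections B E) :
    ContDiffAt ℝ ∞ (fun z => ∑ j, Complex.normSq (localCoord x (s j) z))
      (extChartAt 𝓘(ℂ, B) x x) := by
  refine ContDiffAt.sum fun j _ => ?_
  have h1 : ContDiffAt ℝ ∞ (localCoord x (s j)) (extChartAt 𝓘(ℂ, B) x x) :=
    ((contDiffAt_localCoord x (s j)).restrict_scalars ℝ).of_le le_top
  simp only [Complex.normSq_eq_norm_sq]
  exact h1.norm_sq ℝ

theorem log_bergmanFunction_eventuallyEq (h : HermitianMetric B E) (hg : IsPosDefInner g)
    (hb : ∀ i j, g (b i) (b j) = if i = j then 1 else 0) {x : X}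
    (hx : 0 < bergmanFunction h (delta V g) x) :
    (fun z => Real.log (bergmanFunction h (delta V g) ((extChartAt 𝓘(ℂ, B) x).symm z)))
      =ᶠ[nhds (extChartAt 𝓘(ℂ, B) x x)]
        fun z => Real.log (h.frameNormSq x ((extChartAt 𝓘(ℂ, B) x).symm z)) +
          Real.log (∑ j, Complex.normSq (localCoord x (b j : HolSections B E) z)) := by
  have hpos := (bergmanFunction_pos_iff_sum_normSq_pos h hg hb x).mp hx
  filter_upwards [frameDomain_mem_nhds (E := E) x,
    (contDiffAt_sum_normSq_localCoord x fun j => (b j : HolSections B E)).continuousAt.eventually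
      (lt_mem_nhds hpos)] with z hz hz'
  rw [bergmanFunction_eq_frameNormSq_mul h hg hb hz,
    Real.log_mul (h.frameNormSq_pos hz.2).ne' hz'.ne']

omit [IsManifold 𝓘(ℂ, B) ω X] [ContMDiffVectorBundle ω ℂ E 𝓘(ℂ, B)] in
theorem HermitianMetric.contDiffAt_log_frameNormSq (h : HermitianMetric B E) (x : X) :
    ContDiffAt ℝ ∞ (fun z => Real.log (h.frameNormSq x ((extChartAt 𝓘(ℂ, B) x).symm z)))
      (extChartAt 𝓘(ℂ, B) x x) :=
  (h.contDiffAt_frameNormSq x).log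
    (h.frameNormSq_pos (extChartAt_mem_frameDomain (E := E) x).2).ne'

theorem contMDiff_log_bergmanFunction (h : HermitianMetric B E) (hg : IsPosDefInner g)
    (hb : ∀ i j, g (b i) (b j) = if i = j then 1 else 0)
    (hpos : ∀ x, 0 < bergmanFunction h (delta V g) x) :
    ContMDiff 𝓘(ℝ, B) 𝓘(ℝ, ℝ) ∞ fun x => Real.log (bergmanFunction h (delta V g) x) := by
  intro x
  refine contMDiffAt_real_iff.mpr (ContDiffAt.congr_of_eventuallyEq ?_
    (log_bergmanFunction_eventuallyEq h hg hb (hpos x)))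
  exact (h.contDiffAt_log_frameNormSq x).add ((contDiffAt_sum_normSq_localCoord x _).log
    ((bergmanFunction_pos_iff_sum_normSq_pos h hg hb x).mp (hpos x)).ne')

/-- In a local frame, `ω + i∂∂̄ log κ` is `i∂∂̄ log ∑ |φ_j|²`. -/
theorem omega_add_ddbar_log_bergmanFunction (h : HermitianMetric B E) (hg : IsPosDefInner g)
    (hb : ∀ i j, g (b i) (b j) = if i = j then 1 else 0) {x : X}
    (hx : 0 < bergmanFunction h (delta V g) x) (v w : B) :
    h.omega x v w +
        Complex.I * ddbar (fun x => Real.log (bergmanFunction h (delta V g) x)) x v w =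
      Complex.I * delDelBar (fun z => (Real.log (∑ j, Complex.normSq
        (localCoord x (b j : HolSections B E) z)) : ℂ)) (extChartAt 𝓘(ℂ, B) x x) v w := by
  have hpos := (bergmanFunction_pos_iff_sum_normSq_pos h hg hb x).mp hx
  have hof : ∀ {f : B → ℝ} {z : B}, ContDiffAt ℝ ∞ f z →
      ContDiffAt ℝ 2 (fun y => (f y : ℂ)) z := fun hf =>
    Complex.ofRealCLM.contDiff.contDiffAt.comp _ (hf.of_le ENat.LEInfty.out)
  have h1 : ddbar (fun x => Real.log (bergmanFunction h (delta V g) x)) x v w =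
      ddbar (fun y => Real.log (h.frameNormSq x y)) x v w +
        delDelBar (fun z => (Real.log (∑ j, Complex.normSq
          (localCoord x (b j : HolSections B E) z)) : ℂ)) (extChartAt 𝓘(ℂ, B) x x) v w := by
    refine Eq.trans (delDelBar_congr ?_ v w) (delDelBar_add
      (hof (h.contDiffAt_log_frameNormSq x))
      (hof ((contDiffAt_sum_normSq_localCoord x _).log hpos.ne')) v w)
    filter_upwards [log_bergmanFunction_eventuallyEq h hg hb hx] with z hz
    rw [hz, Complex.ofReal_add]
  -- This term carries the sign opposite to the frame term of
  -- $i\partial\overline\partial\log\kappa$, and the two cancel.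
  have h2 : h.omega x v w = Complex.I * -ddbar (fun y => Real.log (h.frameNormSq x y)) x v w := rfl
  rw [h1, h2]
  ring

/-- `ω + i∂∂̄ log κ` is positive on `v` if and only if some section in `V` vanishes at `x` to first
order in the direction `v`. -/
theorem omega_add_ddbar_re_pos_iff (h : HermitianMetric B E) (hg : IsPosDefInner g)
    (hb : ∀ i j, g (b i) (b j) = if i = j then 1 else 0) {x : X}
    (hx : 0 < bergmanFunction h (delta V g) x) (v : B) :
    0 < (h.omega x v (Complex.I • v) + Complex.I *
        ddbar (fun x => Real.log (bergmanFunction h (delta V g) x)) x v (Complex.I • v)).re ↔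
      ∃ t ∈ V, t x = 0 ∧ fderiv ℂ (localCoord x t) (extChartAt 𝓘(ℂ, B) x x) v ≠ 0 := by
  have hpos := (bergmanFunction_pos_iff_sum_normSq_pos h hg hb x).mp hx
  set z₀ := extChartAt 𝓘(ℂ, B) x x with hz₀
  set φ : Fin n → B → ℂ := fun j => localCoord x (b j : HolSections B E) with hφ
  have hd : ∀ j, ContDiffAt ℂ ω (φ j) z₀ := fun j => contDiffAt_localCoord x _
  have ha : (fun j => φ j z₀) ≠ 0 := fun h0 => by
    have : ∀ j, φ j z₀ = 0 := congrFun h0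
    rw [Finset.sum_eq_zero fun j _ => by rw [Complex.normSq_eq_zero]; exact this j] at hpos
    exact hpos.false
  have hcomb : ∀ c : Fin n → ℂ, localCoord x (∑ j, c j • (b j : HolSections B E))
      =ᶠ[nhds z₀] fun z => ∑ j, c j * φ j z := fun c => by
    filter_upwards [frameDomain_mem_nhds (E := E) x] with z hz
    exact localCoord_sum_smul hz _ _ _
  have hcomb' : ∀ c : Fin n → ℂ, fderiv ℂ (localCoord x (∑ j, c j • (b j : HolSections B E))) z₀ v =
      ∑ j, c j * fderiv ℂ (φ j) z₀ v := fun c => by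
    rw [(hcomb c).fderiv_eq, fderiv_fun_sum fun j _ =>
      ((hd j).differentiableAt (by simp)).const_mul _]
    simp only [sum_apply]
    refine Finset.sum_congr rfl fun j _ => ?_
    rw [fderiv_const_mul ((hd j).differentiableAt (by simp))]
    rfl
  rw [omega_add_ddbar_log_bergmanFunction h hg hb hx,
    I_mul_delDelBar_log_sum (fun j => (hd j).of_le le_top) hpos]
  have hre : (2 * gramDet (fun j => φ j z₀) (fun j => fderiv ℂ (φ j) z₀ v) /
      ((∑ j, Complex.normSq (φ j z₀) : ℝ) : ℂ) ^ 2).re =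
      2 / (∑ j, Complex.normSq (φ j z₀)) ^ 2 *
        (gramDet (fun j => φ j z₀) (fun j => fderiv ℂ (φ j) z₀ v)).re := by
    rw [← Complex.re_ofReal_mul]
    push_cast
    ring_nf
  rw [hre, mul_pos_iff_of_pos_left (by positivity), gramDet_re_pos_iff ha]
  constructor
  -- The vector $c$ supplies the coefficients of $t$ in the orthonormal basis; conversely, the
  -- coordinates of $t$ serve as $c$.
  · rintro ⟨c, hc, hc'⟩
    refine ⟨∑ j, c j • (b j : HolSections B E),
      V.sum_mem fun j _ => V.smul_mem _ (b j).2, ?_, ?_⟩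
    · rw [← localCoord_extChartAt_eq_zero_iff, (hcomb c).self_of_nhds]
      exact hc
    · rwa [hcomb' c]
  · rintro ⟨t, ht, htx, htv⟩
    have hrepr : t = ∑ j, b.repr ⟨t, ht⟩ j • (b j : HolSections B E) := by
      have h1 := congrArg V.subtype (b.sum_repr ⟨t, ht⟩).symm
      simp only [map_sum, map_smul] at h1
      exact h1
    rw [← localCoord_extChartAt_eq_zero_iff, hrepr, (hcomb _).self_of_nhds] at htx
    rw [hrepr, hcomb'] at htv
    exact ⟨_, htx, htv⟩

end Bergman

end BergmanLine
end

theorem lemma6p1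
    {B : Type*} [NormedAddCommGroup B] [NormedSpace ℂ B] [FiniteDimensional ℂ B]
    {X : Type*} [TopologicalSpace X] [T2Space X] [CompactSpace X] [ChartedSpace B X]
    [IsManifold 𝓘(ℂ, B) ω X]
    {E : X → Type*} [TopologicalSpace (Bundle.TotalSpace ℂ E)]
    [∀ x, TopologicalSpace (E x)] [∀ x, AddCommGroup (E x)] [∀ x, Module ℂ (E x)]
    [FiberBundle ℂ E] [VectorBundle ℂ ℂ E] [ContMDiffVectorBundle ω ℂ E 𝓘(ℂ, B)]
    (h : BergmanLine.HermitianMetric B E)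
    (V : Submodule ℂ (BergmanLine.HolSections B E))
    (g : V →ₗ[ℂ] V →ₗ⋆[ℂ] ℂ) (hg : BergmanLine.IsPosDefInner g) :
    ((∀ x, 0 < BergmanLine.bergmanFunction h (BergmanLine.delta V g) x) ∧
      (fun x => Real.log (BergmanLine.bergmanFunction h (BergmanLine.delta V g) x)) ∈
        BergmanLine.potentials h.omega) ↔
    BergmanLine.IsRatherAmple V := by
  have := h.finiteDimensional_holSections
  obtain ⟨n, b, hb⟩ := hg.exists_orthonormal_basis
  constructor
  · rintro ⟨hpos, -, hpot⟩ x
    refine ⟨(BergmanLine.bergmanFunction_pos_iff h hg hb x).mp (hpos x), fun v hv => ?_⟩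
    obtain ⟨t, ht, htx, htv⟩ :=
      (BergmanLine.omega_add_ddbar_re_pos_iff h hg hb (hpos x) v).mp (hpot x v hv)
    exact ⟨t, ht, htx, fun h0 => htv ((BergmanLine.mfderiv_section_eq x t v).symm.trans h0)⟩
  · intro hV
    have hpos : ∀ x, 0 < BergmanLine.bergmanFunction h (BergmanLine.delta V g) x := fun x =>
      (BergmanLine.bergmanFunction_pos_iff h hg hb x).mpr (hV x).1
    refine ⟨hpos, BergmanLine.contMDiff_log_bergmanFunction h hg hb hpos, fun x v hv => ?_⟩
    obtain ⟨t, ht, htx, htv⟩ := (hV x).2 v hv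
    refine (BergmanLine.omega_add_ddbar_re_pos_iff h hg hb (hpos x) v).mpr ⟨t, ht, htx, fun h0 =>
      htv ((BergmanLine.mfderiv_section_eq x t v).trans h0)⟩
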